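/- **Setting.** Items with sizes $X_1,\dots,X_n$ are packed one at a time, in this order, into unit-capacity bins. When item $i$ arrives, its size distribution and the sizes of the items packed earlier are known; it must be placed irrevocably into an opened bin or into a new one, and only then is its size revealed. A bin overflows when the sizes of its items sum to more than $1$, and an overflowed bin may not be used again. A (deterministic, measurable) policy $\mathcal P$ chooses the bin of each item as a function of the previous sizes and placements; with $N_{\mathcal P}$ the number of opened bins and $O_{\mathcal P}$ the number of overflowed bins after $n$ items, $\mathrm{cost}(\mathcal P)=\mathbb E[N_{\mathcal P}]+C\,\mathbb E[O_{\mathcal P}]$, where $C\ge 1$ is a fixed penalty. The risk of a bin is the sum, over the items $i$ packed into it, of $p_i(S)=\mathbb P_{X_i}(X_i+S>1)$, where $S$ is the usage (the total size of the items in the bin) just before item $i$ is added. A policy is budgeted with risk budget $r$ if, almost surely, no bin has risk larger than $r$. Budgeted Greedy ($\textsc{Alg}$) with parameter $\gamma>0$, which does not know $n$, packs item $i$ into some opened bin that has not overflowed and whose accumulated risk plus $p_i(\text{usage})$ is at most $\gamma/C$, with ties broken arbitrarily; if there is no such bin, it opens a new one. **Theorem.** Let $C\ge1$ and let $X_1,\dots,X_n$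 be i.i.d. nonnegative random variables. 1. For every $\gamma>0$, $\mathbb E[N_{\textsc{Alg}}]\le\mathbb E[N_{\mathcal P}]$ for every policy $\mathcal P$ that is budgeted with risk budget $\gamma/C$; and if $\mathbb P(X_1>1)\le\gamma/C$, then $\textsc{Alg}$ is itself such a policy, so that it attains the minimum. 2. With $\gamma=\sqrt2$, $\mathrm{cost}(\textsc{Alg})\le(3+2\sqrt2)\,\mathrm{cost}(\mathcal P)$ for every policy $\mathcal P$, including policies that know $n$ and the common distribution in advance. Hence $\mathrm{cost}(\textsc{Alg})\le(3+2\sqrt2)\,\mathrm{cost}(\textsc{Opt})$, where $\mathrm{cost}(\textsc{Opt})=\inf_{\mathcal P}\mathrm{cost}(\mathcal P)$. -/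

import Mathlib

open MeasureTheory ProbabilityTheory

noncomputable section

namespace BinPacking

/-- A state after `i` items (items and bins are labelled `0, 1, 2, …`): item `k` had size
`(s k).1` and was packed into the bin with label `(s k).2`. -/
abbrev State (i : ℕ) : Type := Fin i → ℝ × ℕ

namespace State

variable {i : ℕ}

/-- The state just before item `k` was packed. -/
def before (s : State i) (k : Fin i) : State k :=
  fun m => s ⟨m, m.isLt.trans k.isLt⟩

/-- The usage of bin `j`: the total size of the items packed into it. -/
def usage (s : State i) (j : ℕ) : ℝ :=
  ∑ k : Fin i with (s k).2 = j, (s k).1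

/-- The bins that have been opened. -/
def opened (s : State i) : Finset ℕ :=
  Finset.univ.image fun k => (s k).2

/-- The bins that have overflowed. -/
def broken (s : State i) : Finset ℕ :=
  s.opened.filter fun j => 1 < s.usage j

/-- No item was packed into a bin that had already overflowed. -/
def Feasible (s : State i) : Prop :=
  ∀ k : Fin i, (s.before k).usage (s k).2 ≤ 1

end State

/-- The probability that an item with size distribution `μ` overflows a bin of usage `u`. -/
def overflowProb (μ : Measure ℝ) (u : ℝ) : ℝ :=
  μ.real {x | 1 < x + u}

/-- The risk accumulated by bin `j`, when item `k` has size distribution `D k`: the sum over the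
items packed into the bin of the probability, at the moment of packing, of overflowing it. -/
def State.risk {i : ℕ} (D : ℕ → Measure ℝ) (s : State i) (j : ℕ) : ℝ :=
  ∑ k : Fin i with (s k).2 = j, overflowProb (D k) ((s.before k).usage j)

/-- A deterministic policy: in every state it chooses the label of the bin for the next item. -/
structure Policy where
  bin : ∀ i : ℕ, State i → ℕ
  measurable_bin : ∀ i : ℕ, Measurable (bin i)

namespace Policy

/-- The state reached by the policy when the items have sizes `x 0, …, x (n - 1)`. -/
def run (P : Policy) : {n : ℕ} → (Fin n → ℝ) → State n
  | 0, _ => Fin.elim0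
  | n + 1, x =>
      Fin.snoc (P.run (Fin.init x)) (x (Fin.last n), P.bin n (P.run (Fin.init x)))

variable {n : ℕ} {Ω : Type*} [MeasurableSpace Ω]

/-- For the random items `X 0, …, X (n - 1)`, the policy never uses an overflowed bin. -/
def IsFeasible (P : Policy) (X : Fin n → Ω → ℝ) (Pr : Measure Ω) : Prop :=
  ∀ᵐ ω ∂Pr, (P.run fun i => X i ω).Feasible

/-- For the random items `X 0, …, X (n - 1)` (of laws `D 0, …, D (n - 1)`), no bin ever
accumulates a risk larger than `r`. -/
def IsBudgeted (P : Policy) (D : ℕ → Measure ℝ) (r : ℝ) (X : Fin n → Ω → ℝ) (Pr : Measure Ω) :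
    Prop :=
  ∀ᵐ ω ∂Pr, ∀ j : ℕ, (P.run fun i => X i ω).risk D j ≤ r

/-- The expected number of opened bins. -/
def expectedOpened (P : Policy) (X : Fin n → Ω → ℝ) (Pr : Measure Ω) : ℝ :=
  ∫ ω, ((P.run fun i => X i ω).opened.card : ℝ) ∂Pr

/-- The expected number of overflowed bins. -/
def expectedBroken (P : Policy) (X : Fin n → Ω → ℝ) (Pr : Measure Ω) : ℝ :=
  ∫ ω, ((P.run fun i => X i ω).broken.card : ℝ) ∂Pr

/-- The expected cost: one for each opened bin and `C` for each overflowed bin. -/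
def cost (P : Policy) (C : ℝ) (X : Fin n → Ω → ℝ) (Pr : Measure Ω) : ℝ :=
  P.expectedOpened X Pr + C * P.expectedBroken X Pr

end Policy

/-- In state `s`, the next item may be added to the open bin `j`: the bin has not overflowed,
and with the risk of the new item its risk stays within the budget `r`. -/
def State.CanAdd {i : ℕ} (D : ℕ → Measure ℝ) (r : ℝ) (s : State i) (j : ℕ) : Prop :=
  j ∈ s.opened ∧ s.usage j ≤ 1 ∧ s.risk D j + overflowProb (D i) (s.usage j) ≤ r

/-- `A` is Budgeted Greedy with risk budget `r`, with some way of breaking ties: in every state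
that it reaches it packs the next item into an open bin that can take it, if there is one, and
otherwise opens the unused bin with the smallest label. The number of items plays no role. -/
def IsBudgetedGreedy (D : ℕ → Measure ℝ) (r : ℝ) (A : Policy) : Prop :=
  ∀ (i : ℕ) (x : Fin i → ℝ), (∀ k, 0 ≤ x k) →
    ((∃ j, (A.run x).CanAdd D r j) → (A.run x).CanAdd D r (A.bin i (A.run x))) ∧
    ((¬ ∃ j, (A.run x).CanAdd D r j) →
      IsLeast {j : ℕ | j ∉ (A.run x).opened} (A.bin i (A.run x)))

end BinPacking

end

/-! Let r be the risk budget and p(u) the probability that an item overflows a bin of usage u. The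
core is a relaxed problem: every label holds a current bin, replaced by an empty one when it cannot
take the next item within capacity and budget, and only the empty bins used are counted. `minOpen`
is the value of its Bellman recursion, taken in [0,∞] so that infima and Tonelli need no
integrability. In the relaxed problem it is optimal to use an accepting bin i
(`minOpen_succ_of_accepts`): if another label j is tried first, the two moves can be exchanged,
since the sizes are i.i.d. and each move changes only its own label. If no bin accepts, all labels
are equivalent. Hence Budgeted Greedy attains `minOpen`, while any policy P, read in the relaxed
problem, uses on average at least that many bins (`lintegral_card_opened_greedy_le`). If P respects
the budget, nothing is ever replaced and its relaxed count is its number of opened bins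
(`State.tracks_of_budgeted`); this is the optimality claim. For an arbitrary feasible P, a bin is
replaced only when its risk together with that of the incoming item exceeds r. Charging each item at
most twice, once to the bin it closes and once to the bin it enters, bounds r times the relaxed
count by r·N_P plus twice the total risk (`State.mul_refills_le`). Expected total risk equals the
expected number of overflows (`lintegral_card_broken`), so E N_Alg ≤ E N_P + (2/r) E O_P. As for the
overflows of Alg: if p(0) ≤ r, each of its bins has risk at most r, so E O_Alg ≤ r E N_Alg; if p(0)
> r, it gives every item its own bin and its total risk n·p(0) is the least possible. -/

noncomputable section

open scoped ENNReal

namespace BinPacking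

/-! ### The value of refilling a family of bins -/

section Refill

variable (p : ℝ → ℝ) (r : ℝ)

/-- A bin with usage `b.1` and accumulated risk `b.2` can take one more item. -/
def Accepts (b : ℝ × ℝ) : Prop := b.1 ≤ 1 ∧ b.2 + p b.1 ≤ r

open Classical in
/-- Put an item of size `x` into the bin if it can take it, and into an empty bin otherwise. -/
def refill (b : ℝ × ℝ) (x : ℝ) : ℝ × ℝ :=
  if Accepts p r b then (b.1 + x, b.2 + p b.1) else (x, p 0)

open Classical in
/-- The number of empty bins that `refill` uses. -/
def openCost (b : ℝ × ℝ) : ℕ := if Accepts p r b then 0 else 1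

/-- The least expected number of empty bins used for packing `m` more items, when every label `j`
holds one bin, with load `φ j`, which has to be replaced by an empty one when it is full. -/
def minOpen (μ : Measure ℝ) : ℕ → (ℕ → ℝ × ℝ) → ℝ≥0∞
  | 0, _ => 0
  | m + 1, φ => ⨅ j, ((openCost p r (φ j) : ℝ≥0∞) +
      ∫⁻ x, minOpen μ m (Function.update φ j (refill p r (φ j) x)) ∂μ)

variable {p r}

lemma measurableSet_accepts (hp : Measurable p) : MeasurableSet {b | Accepts p r b} :=
  (measurableSet_le measurable_fst measurable_const).inter
    (measurableSet_le (measurable_snd.add (hp.comp measurable_fst)) measurable_const)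

lemma measurable_refill (hp : Measurable p) :
    Measurable fun q : (ℝ × ℝ) × ℝ => refill p r q.1 q.2 := by
  unfold refill
  refine Measurable.ite (measurable_fst (measurableSet_accepts hp)) ?_ ?_
  · fun_prop
  · fun_prop

lemma measurable_openCost (hp : Measurable p) : Measurable (openCost p r) :=
  Measurable.ite (measurableSet_accepts hp) measurable_const measurable_const

lemma measurable_update_refill (hp : Measurable p) (j : ℕ) :
    Measurable fun q : (ℕ → ℝ × ℝ) × ℝ =>
      Function.update q.1 j (refill p r (q.1 j) q.2) := by
  refine measurable_pi_iff.2 fun k => ?_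
  by_cases h : k = j
  · subst h
    simp only [Function.update_self]
    have h : Measurable fun q : (ℕ → ℝ × ℝ) × ℝ => (q.1 k, q.2) := by fun_prop
    exact (measurable_refill hp).comp h
  · simp only [Function.update_of_ne h]
    exact (measurable_pi_apply k).comp measurable_fst

variable {μ : Measure ℝ}

lemma measurable_minOpen [SFinite μ] (hp : Measurable p) (m : ℕ) : Measurable (minOpen p r μ m) := by
  induction m with
  | zero => exact measurable_const
  | succ m ih =>
    refine Measurable.iInf fun j => Measurable.fun_add ?_ ?_
    · exact (measurable_from_top (f := fun k : ℕ => (k : ℝ≥0∞))).comp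
        ((measurable_openCost hp).comp (measurable_pi_apply j))
    · exact (ih.comp (measurable_update_refill hp j)).lintegral_prod_right'

lemma minOpen_succ_le (m : ℕ) (φ : ℕ → ℝ × ℝ) (j : ℕ) :
    minOpen p r μ (m + 1) φ ≤ (openCost p r (φ j) : ℝ≥0∞) +
      ∫⁻ x, minOpen p r μ m (Function.update φ j (refill p r (φ j) x)) ∂μ :=
  iInf_le _ j

/-- It is optimal to use a bin that can take the item, whichever it is. -/
lemma minOpen_succ_of_accepts [IsProbabilityMeasure μ] (hp : Measurable p) (m : ℕ)
    (φ : ℕ → ℝ × ℝ) (i : ℕ)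
    (hi : Accepts p r (φ i)) :
    minOpen p r μ (m + 1) φ =
      ∫⁻ x, minOpen p r μ m (Function.update φ i (refill p r (φ i) x)) ∂μ := by
  refine le_antisymm ((minOpen_succ_le m φ i).trans_eq (by simp [openCost, hi])) ?_
  induction m generalizing φ with
  | zero => simp [minOpen]
  | succ m ih =>
    refine le_iInf fun j => ?_
    by_cases hj : j = i
    · subst hj
      exact le_add_self
    have hup (y : ℝ) : Function.update φ j (refill p r (φ j) y) i = φ i :=
      Function.update_of_ne (Ne.symm hj) _ _
    have hup' (x : ℝ) : Function.update φ i (refill p r (φ i) x) j = φ j :=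
      Function.update_of_ne hj _ _
    have hmeas : Measurable fun q : ℝ × ℝ => minOpen p r μ m
        (Function.update (Function.update φ j (refill p r (φ j) q.1)) i
          (refill p r (φ i) q.2)) := by
      refine (measurable_minOpen hp m).comp (measurable_pi_iff.2 fun k => ?_)
      have h1 : Measurable fun q : ℝ × ℝ => refill p r (φ j) q.1 :=
        (measurable_refill hp).comp (measurable_const.prodMk measurable_fst)
      have h2 : Measurable fun q : ℝ × ℝ => refill p r (φ i) q.2 :=
        (measurable_refill hp).comp (measurable_const.prodMk measurable_snd)
      by_cases hk : k = i
      · subst hk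
        simpa using h2
      by_cases hk' : k = j
      · subst hk'
        simpa [Function.update_of_ne hk] using h1
      · simp [Function.update_of_ne hk, Function.update_of_ne hk']
    -- Exchange argument: after serving i first, play j next. The two updates commute and Tonelli
    -- swaps the two sizes, so this is the same as playing j first and i second.
    calc ∫⁻ x, minOpen p r μ (m + 1) (Function.update φ i (refill p r (φ i) x)) ∂μ
        ≤ ∫⁻ x, ((openCost p r (φ j) : ℝ≥0∞) + ∫⁻ y, minOpen p r μ m
            (Function.update (Function.update φ j (refill p r (φ j) y)) i
              (refill p r (φ i) x)) ∂μ) ∂μ := by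
          refine lintegral_mono fun x => ?_
          refine (minOpen_succ_le m _ j).trans_eq ?_
          simp only [hup']
          congr 2
          ext y
          rw [Function.update_comm hj]
      _ = (openCost p r (φ j) : ℝ≥0∞) + ∫⁻ y, ∫⁻ x, minOpen p r μ m
            (Function.update (Function.update φ j (refill p r (φ j) y)) i
              (refill p r (φ i) x)) ∂μ ∂μ := by
          rw [lintegral_add_left measurable_const, lintegral_lintegral_swap (f := fun x y =>
            minOpen p r μ m (Function.update (Function.update φ j (refill p r (φ j) y)) i
              (refill p r (φ i) x))) (hmeas.comp measurable_swap).aemeasurable]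
          simp
      _ ≤ _ := by
          -- After the move at j, bin i is untouched and still accepts, so the induction hypothesis
          -- applies to the updated loads.
          gcongr with y
          have := ih (Function.update φ j (refill p r (φ j) y)) (by rwa [hup])
          rwa [hup] at this

/-- The expected number of empty bins used for `m` more items packed through a single label. -/
def nextFitOpen (p : ℝ → ℝ) (r : ℝ) (μ : Measure ℝ) : ℕ → ℝ × ℝ → ℝ≥0∞
  | 0, _ => 0
  | m + 1, b => (openCost p r b : ℝ≥0∞) + ∫⁻ x, nextFitOpen p r μ m (refill p r b x) ∂μ

/-- With at most one accepting bin there is nothing to choose: that bin is used while it accepts,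
and once it is full every label gives the same fresh bin. The right side depends on the load alone,
which makes labels interchangeable. -/
lemma minOpen_eq_nextFitOpen [IsProbabilityMeasure μ] (hp : Measurable p) (m : ℕ)
    (φ : ℕ → ℝ × ℝ) (i : ℕ)
    (h : ∀ j, j ≠ i → ¬ Accepts p r (φ j)) : minOpen p r μ m φ = nextFitOpen p r μ m (φ i) := by
  induction m generalizing φ i with
  | zero => rfl
  | succ m ih =>
    by_cases hi : Accepts p r (φ i)
    · rw [minOpen_succ_of_accepts hp m φ i hi]
      simp only [nextFitOpen, openCost, hi, if_true, Nat.cast_zero, zero_add]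
      refine lintegral_congr fun x => ?_
      rw [ih _ i fun j hj => by rw [Function.update_of_ne hj]; exact h j hj]
      simp
    · have hd (j : ℕ) : ¬ Accepts p r (φ j) := by
        by_cases hj : j = i
        · rwa [hj]
        · exact h j hj
      have hj (j : ℕ) : ((openCost p r (φ j) : ℝ≥0∞) +
          ∫⁻ x, minOpen p r μ m (Function.update φ j (refill p r (φ j) x)) ∂μ)
          = nextFitOpen p r μ (m + 1) (φ i) := by
        simp only [nextFitOpen, openCost, refill, hd, if_false]
        congr 1
        refine lintegral_congr fun x => ?_
        rw [ih _ j fun k hk => by rw [Function.update_of_ne hk]; exact hd k]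
        simp
      simp only [minOpen, hj, iInf_const]

/-- If no bin can take the item, the label of the new bin does not matter. -/
lemma minOpen_succ_of_not_accepts [IsProbabilityMeasure μ] (hp : Measurable p) (m : ℕ)
    (φ : ℕ → ℝ × ℝ)
    (h : ∀ j, ¬ Accepts p r (φ j)) (j : ℕ) :
    minOpen p r μ (m + 1) φ = (openCost p r (φ j) : ℝ≥0∞) +
      ∫⁻ x, minOpen p r μ m (Function.update φ j (refill p r (φ j) x)) ∂μ := by
  rw [minOpen_eq_nextFitOpen hp (m + 1) φ j fun k _ => h k, nextFitOpen]
  congr 1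
  refine lintegral_congr fun x => ?_
  rw [minOpen_eq_nextFitOpen hp m _ j fun k hk => by
    rw [Function.update_of_ne hk]; exact h k]
  simp

end Refill

/-! ### Adding one item to a state -/

namespace State

variable {i : ℕ}

/-- The state after an item of size `x` has been packed into bin `j`. -/
def push (s : State i) (x : ℝ) (j : ℕ) : State (i + 1) :=
  Fin.snoc (α := fun _ => ℝ × ℕ) s (x, j)

@[simp] lemma push_last (s : State i) (x : ℝ) (j : ℕ) : s.push x j (Fin.last i) = (x, j) := by
  simp [push]

@[simp] lemma push_castSucc (s : State i) (x : ℝ) (j : ℕ) (k : Fin i) :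
    s.push x j k.castSucc = s k := by
  simp [push]

@[simp] lemma init_push (s : State i) (x : ℝ) (j : ℕ) :
    Fin.init (α := fun _ => ℝ × ℕ) (s.push x j) = s := by
  ext k : 1
  simp [Fin.init]

lemma push_init (s : State (i + 1)) :
    push (Fin.init (α := fun _ => ℝ × ℕ) s) (s (Fin.last i)).1 (s (Fin.last i)).2 = s :=
  Fin.snoc_init_self _

@[elab_as_elim]
lemma pushInduction {motive : ∀ {i : ℕ}, State i → Prop} (zero : ∀ s : State 0, motive s)
    (push : ∀ {i : ℕ} (s : State i) (x : ℝ) (j : ℕ), motive s → motive (s.push x j)) :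
    ∀ {i : ℕ} (s : State i), motive s
  | 0, s => zero s
  | _ + 1, s => push_init s ▸ push _ _ _ (pushInduction zero push _)

lemma before_push_last (s : State i) (x : ℝ) (j : ℕ) : (s.push x j).before (Fin.last i) = s := by
  funext m
  exact push_castSucc s x j m

lemma before_push_castSucc (s : State i) (x : ℝ) (j : ℕ) (k : Fin i) :
    (s.push x j).before k.castSucc = s.before k := by
  funext m
  exact push_castSucc s x j ⟨m, m.isLt.trans k.isLt⟩

lemma usage_push (s : State i) (x : ℝ) (j l : ℕ) :
    (s.push x j).usage l = s.usage l + if j = l then x else 0 := by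
  simp [usage, Finset.sum_filter, Fin.sum_univ_castSucc]

@[simp] lemma usage_before_push_castSucc (s : State i) (x : ℝ) (j l : ℕ) (k : Fin i) :
    ((s.push x j).before k.castSucc).usage l = (s.before k).usage l :=
  congrArg (usage · l) (before_push_castSucc s x j k)

@[simp] lemma usage_before_push_last (s : State i) (x : ℝ) (j l : ℕ) :
    ((s.push x j).before (Fin.last i)).usage l = s.usage l :=
  congrArg (usage · l) (before_push_last s x j)

lemma mem_opened {s : State i} {j : ℕ} : j ∈ s.opened ↔ ∃ k, (s k).2 = j := by
  simp [opened]

lemma opened_push (s : State i) (x : ℝ) (j : ℕ) : (s.push x j).opened = insert j s.opened := by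
  ext l
  simp [mem_opened, Fin.exists_fin_succ', eq_comm, or_comm]

lemma usage_of_notMem {s : State i} {j : ℕ} (h : j ∉ s.opened) : s.usage j = 0 := by
  refine Finset.sum_eq_zero fun k hk => absurd ?_ h
  exact mem_opened.2 ⟨k, (Finset.mem_filter.1 hk).2⟩

lemma feasible_push {s : State i} {x : ℝ} {j : ℕ} :
    (s.push x j).Feasible ↔ s.Feasible ∧ s.usage j ≤ 1 := by
  unfold Feasible
  constructor
  · intro h
    refine ⟨fun k => ?_, ?_⟩
    · have := h k.castSucc
      rwa [push_castSucc, usage_before_push_castSucc] at this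
    · have := h (Fin.last i)
      rwa [push_last, usage_before_push_last] at this
  · rintro ⟨h, h'⟩ k
    refine Fin.lastCases ?_ (fun k => ?_) k
    · rwa [push_last, usage_before_push_last]
    · rw [push_castSucc, usage_before_push_castSucc]
      exact h k

lemma mem_broken {s : State i} {j : ℕ} : j ∈ s.broken ↔ j ∈ s.opened ∧ 1 < s.usage j :=
  Finset.mem_filter

lemma card_broken_push {s : State i} {x : ℝ} {j : ℕ} (h : s.usage j ≤ 1) :
    (s.push x j).broken.card = s.broken.card + if 1 < x + s.usage j then 1 else 0 := by
  have hj : j ∉ s.broken := fun hj => not_lt.2 h (mem_broken.1 hj).2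
  split_ifs with hx
  · rw [← Finset.card_insert_of_notMem hj]
    congr 1
    ext l
    by_cases hl : l = j
    · subst hl
      simp [mem_broken, opened_push, usage_push, add_comm, hx]
    · simp [mem_broken, opened_push, usage_push, hl, Ne.symm hl]
  · rw [add_zero]
    congr 1
    ext l
    by_cases hl : l = j
    · subst hl
      simp [mem_broken, opened_push, usage_push, add_comm, hx, h]
    · simp [mem_broken, opened_push, usage_push, hl, Ne.symm hl]

lemma risk_push (μ : Measure ℝ) (s : State i) (x : ℝ) (j l : ℕ) :
    (s.push x j).risk (fun _ => μ) l =
      s.risk (fun _ => μ) l + if j = l then overflowProb μ (s.usage j) else 0 := by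
  simp only [risk, Finset.sum_filter, Fin.sum_univ_castSucc, push_castSucc, push_last,
    usage_before_push_castSucc, usage_before_push_last]
  congr 1
  split_ifs with h
  · rw [h]
  · rfl

lemma risk_of_notMem {s : State i} {D : ℕ → Measure ℝ} {j : ℕ} (h : j ∉ s.opened) :
    s.risk D j = 0 := by
  refine Finset.sum_eq_zero fun k hk => absurd ?_ h
  exact mem_opened.2 ⟨k, (Finset.mem_filter.1 hk).2⟩

/-- The sum of the risks of all bins. -/
def totalRisk (μ : Measure ℝ) (s : State i) : ℝ :=
  ∑ k : Fin i, overflowProb μ ((s.before k).usage (s k).2)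

lemma totalRisk_push (μ : Measure ℝ) (s : State i) (x : ℝ) (j : ℕ) :
    (s.push x j).totalRisk μ = s.totalRisk μ + overflowProb μ (s.usage j) := by
  simp [totalRisk, Fin.sum_univ_castSucc]

lemma totalRisk_eq_sum_risk (μ : Measure ℝ) (s : State i) :
    s.totalRisk μ = ∑ j ∈ s.opened, s.risk (fun _ => μ) j := by
  rw [totalRisk, ← Finset.sum_fiberwise_of_maps_to (t := s.opened) (g := fun k => (s k).2)
    fun k _ => mem_opened.2 ⟨k, rfl⟩]
  refine Finset.sum_congr rfl fun j _ => Finset.sum_congr rfl fun k hk => ?_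
  rw [(Finset.mem_filter.1 hk).2]

end State

/-! ### Bounds on the overflow probability -/

section OverflowProb

variable (μ : Measure ℝ)

lemma overflowProb_nonneg (u : ℝ) : 0 ≤ overflowProb μ u := measureReal_nonneg

lemma monotone_overflowProb [IsFiniteMeasure μ] : Monotone (overflowProb μ) := fun u v h =>
  measureReal_mono fun x (hx : 1 < x + u) => show 1 < x + v by linarith

lemma overflowProb_le_one [IsProbabilityMeasure μ] (u : ℝ) : overflowProb μ u ≤ 1 :=
  measureReal_le_one

lemma measurable_overflowProb [IsFiniteMeasure μ] : Measurable (overflowProb μ) :=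
  (monotone_overflowProb μ).measurable

end OverflowProb

/-! ### The loads of the bins when each bin is replaced as soon as its budget is exhausted -/

namespace State

section Loads

variable (p : ℝ → ℝ) (r : ℝ)

/-- The current load of each label, when the bin of a label is replaced by an empty one if it
cannot take the next item; the load `(2, 0)` marks labels that have not been used. -/
def loads : {i : ℕ} → State i → ℕ → ℝ × ℝ
  | 0, _ => fun _ => (2, 0)
  | i + 1, s =>
    Function.update (loads (Fin.init (α := fun _ => ℝ × ℕ) s)) (s (Fin.last i)).2
      (refill p r (loads (Fin.init (α := fun _ => ℝ × ℕ) s) (s (Fin.last i)).2)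
        (s (Fin.last i)).1)

/-- The number of bins used when each bin is replaced as soon as its budget is exhausted. -/
def refills : {i : ℕ} → State i → ℕ
  | 0, _ => 0
  | i + 1, s => refills (Fin.init (α := fun _ => ℝ × ℕ) s) +
      openCost p r (loads p r (Fin.init (α := fun _ => ℝ × ℕ) s) (s (Fin.last i)).2)

variable {i : ℕ}

lemma loads_push (s : State i) (x : ℝ) (j : ℕ) :
    (s.push x j).loads p r = Function.update (s.loads p r) j (refill p r (s.loads p r j) x) := by
  simp [loads]

lemma refills_push (s : State i) (x : ℝ) (j : ℕ) :
    (s.push x j).refills p r = s.refills p r + openCost p r (s.loads p r j) := by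
  simp [refills]

/-- The fictitious usage 2 exceeds the capacity, so the first use of a label is counted as one empty
bin. -/
lemma not_accepts_unused : ¬ Accepts p r (2, 0) := fun h => by
  have := h.1
  norm_num at this

lemma loads_of_notMem (s : State i) : ∀ {j : ℕ}, j ∉ s.opened → s.loads p r j = (2, 0) := by
  induction s using pushInduction with
  | zero s => intro j _; rfl
  | push s x k ih =>
    intro j hj
    rw [opened_push, Finset.mem_insert, not_or] at hj
    rw [loads_push, Function.update_of_ne hj.1, ih hj.2]

end Loads

/-! ### States in which the relaxed process agrees with the actual bins -/

section Tracks

variable {μ : Measure ℝ} {r : ℝ} {i : ℕ}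

/-- No label has had its bin replaced. -/
def Tracks (μ : Measure ℝ) (r : ℝ) (s : State i) : Prop :=
  (∀ j ∈ s.opened, s.loads (overflowProb μ) r j = (s.usage j, s.risk (fun _ => μ) j)) ∧
    s.refills (overflowProb μ) r = s.opened.card

lemma tracks_zero (s : State 0) : s.Tracks μ r := by
  constructor
  · intro j hj
    simp [opened] at hj
  · simp [refills, opened]

lemma Tracks.accepts_iff {s : State i} (hs : s.Tracks μ r) (j : ℕ) :
    Accepts (overflowProb μ) r (s.loads (overflowProb μ) r j) ↔
      s.CanAdd (fun _ => μ) r j := by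
  by_cases hj : j ∈ s.opened
  · rw [hs.1 j hj]
    exact ⟨fun h => ⟨hj, h⟩, fun h => h.2⟩
  · rw [loads_of_notMem _ _ _ hj]
    exact ⟨fun h => absurd h (not_accepts_unused _ _), fun h => absurd h.1 hj⟩

lemma Tracks.push {s : State i} (hs : s.Tracks μ r) (x : ℝ) {j : ℕ}
    (hj : j ∉ s.opened ∨ s.CanAdd (fun _ => μ) r j) : (s.push x j).Tracks μ r := by
  have hother (l : ℕ) (hl : l ∈ (s.push x j).opened) (hlj : l ≠ j) :
      (s.push x j).loads (overflowProb μ) r l =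
        ((s.push x j).usage l, (s.push x j).risk (fun _ => μ) l) := by
    rw [opened_push, Finset.mem_insert] at hl
    rw [loads_push, Function.update_of_ne hlj, hs.1 l (hl.resolve_left hlj)]
    simp [usage_push, risk_push, hlj.symm]
  rcases hj with hj | hj
  · have hd := loads_of_notMem (overflowProb μ) r s hj
    refine ⟨fun l hl => ?_, ?_⟩
    · by_cases hlj : l = j
      · subst hlj
        simp [loads_push, hd, refill, not_accepts_unused, usage_push, risk_push,
          usage_of_notMem hj, risk_of_notMem hj]
      · exact hother l hl hlj
    · rw [refills_push, hd, hs.2, opened_push, Finset.card_insert_of_notMem hj]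
      simp [openCost, not_accepts_unused]
  · have ha := (hs.accepts_iff j).2 hj
    refine ⟨fun l hl => ?_, ?_⟩
    · by_cases hlj : l = j
      · subst hlj
        simp only [loads_push, refill, ha, if_true, Function.update_self, usage_push, risk_push]
        rw [hs.1 l hj.1]
      · exact hother l hl hlj
    · rw [refills_push, hs.2, opened_push, Finset.insert_eq_of_mem hj.1]
      simp [openCost, ha]

/-- Risk only grows as items are added, so a final bound on it holds at every earlier time; together
with feasibility, each item placed in an open bin was accepted by it. -/
lemma tracks_of_budgeted (s : State i) (hf : s.Feasible)
    (hr : ∀ j, s.risk (fun _ => μ) j ≤ r) : s.Tracks μ r := by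
  induction s using pushInduction with
  | zero s => exact tracks_zero s
  | push s x j ih =>
    obtain ⟨hf, hu⟩ := feasible_push.1 hf
    have hr' (l : ℕ) : s.risk (fun _ => μ) l ≤ r := by
      refine le_trans ?_ (hr l)
      rw [risk_push]
      split_ifs
      · exact le_add_of_nonneg_right (overflowProb_nonneg μ _)
      · simp
    refine (ih hf hr').push x ?_
    by_cases hj : j ∈ s.opened
    · refine Or.inr ⟨hj, hu, ?_⟩
      simpa [risk_push] using hr j
    · exact Or.inl hj

end Tracks

/-! ### Charging replaced bins to the total risk -/

section Nonneg

variable {μ : Measure ℝ} {r : ℝ} {i : ℕ}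

lemma usage_nonneg (s : State i) (h : ∀ k, 0 ≤ (s k).1) (j : ℕ) : 0 ≤ s.usage j :=
  Finset.sum_nonneg fun k _ => h k

lemma nonneg_of_push {s : State i} {x : ℝ} {j : ℕ} (h : ∀ k, 0 ≤ (s.push x j k).1) :
    (∀ k, 0 ≤ (s k).1) ∧ 0 ≤ x := by
  refine ⟨fun k => ?_, ?_⟩
  · simpa using h k.castSucc
  · simpa using h (Fin.last i)

lemma totalRisk_nonneg (s : State i) : 0 ≤ s.totalRisk μ :=
  Finset.sum_nonneg fun _ _ => overflowProb_nonneg μ _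

lemma risk_loads_nonneg (s : State i) (j : ℕ) : 0 ≤ (s.loads (overflowProb μ) r j).2 := by
  induction s using pushInduction with
  | zero s => simp [loads]
  | push s x k ih =>
    rw [loads_push]
    by_cases hjk : j = k
    · subst hjk
      simp only [Function.update_self, refill]
      split_ifs
      · exact add_nonneg ih (overflowProb_nonneg μ _)
      · exact overflowProb_nonneg μ _
    · rwa [Function.update_of_ne hjk]

/-- The current relaxed bin holds only some of the items of the actual bin, and sizes are
nonnegative. By monotonicity of the overflow probability, relaxed risks are then dominated by actual
ones. -/
lemma usage_loads_le (s : State i) (h : ∀ k, 0 ≤ (s k).1) :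
    ∀ j ∈ s.opened, (s.loads (overflowProb μ) r j).1 ≤ s.usage j := by
  induction s using pushInduction with
  | zero s => intro j hj; simp [opened] at hj
  | push s x k ih =>
    intro j hj
    obtain ⟨hs, hx⟩ := nonneg_of_push h
    rw [opened_push, Finset.mem_insert] at hj
    rw [loads_push, usage_push]
    by_cases hjk : j = k
    · subst hjk
      have hu := s.usage_nonneg hs j
      simp only [Function.update_self, refill, if_true]
      split_ifs with ha
      · by_cases hj' : j ∈ s.opened
        · have := ih hs j hj'
          simp only
          linarith
        · rw [loads_of_notMem _ _ _ hj'] at ha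
          exact absurd ha (not_accepts_unused _ _)
      · simp only
        linarith
    · rw [Function.update_of_ne hjk, if_neg (Ne.symm hjk), add_zero]
      exact ih hs j (hj.resolve_left hjk)

variable [IsProbabilityMeasure μ]

lemma mul_overflowProb_zero_le_totalRisk (s : State i) (h : ∀ k, 0 ≤ (s k).1) :
    i * overflowProb μ 0 ≤ s.totalRisk μ := by
  rw [totalRisk]
  have := Finset.card_nsmul_le_sum Finset.univ
    (fun k : Fin i => overflowProb μ ((s.before k).usage (s k).2)) (overflowProb μ 0) fun k _ =>
    monotone_overflowProb μ (usage_nonneg (s.before k) (fun _ => h _) _)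
  simpa using this

lemma totalRisk_le (s : State i) : s.totalRisk μ ≤ i := by
  have := Finset.sum_le_card_nsmul Finset.univ
    (fun k : Fin i => overflowProb μ ((s.before k).usage (s k).2)) 1 fun k _ =>
    overflowProb_le_one μ _
  simpa [totalRisk] using this

/-- Two successive bins with the same label carry together a risk of at least `r`. -/
lemma mul_refills_add_le (s : State i) (h : ∀ k, 0 ≤ (s k).1) (hf : s.Feasible) :
    r * s.refills (overflowProb μ) r + ∑ j ∈ s.opened, (s.loads (overflowProb μ) r j).2 ≤
      r * s.opened.card + 2 * s.totalRisk μ := by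
  induction s using pushInduction with
  | zero s => simp [refills, opened, totalRisk]
  | push s x j ih =>
    have hle := usage_loads_le (μ := μ) (r := r) s (nonneg_of_push h).1
    obtain ⟨hf, hu⟩ := feasible_push.1 hf
    have ih := ih (nonneg_of_push h).1 hf
    have h0 := monotone_overflowProb μ (s.usage_nonneg (nonneg_of_push h).1 j)
    have hupd (b : ℝ × ℝ) (l : ℕ) : (Function.update (s.loads (overflowProb μ) r) j b l).2 =
        Function.update (fun l => (s.loads (overflowProb μ) r l).2) j b.2 l :=
      Function.apply_update (fun _ => Prod.snd) _ _ _ _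
    rw [refills_push, opened_push, totalRisk_push, loads_push]
    simp only [hupd]
    by_cases hj : j ∈ s.opened
    · have hp := monotone_overflowProb μ (hle j hj)
      rw [Finset.insert_eq_of_mem hj, Finset.sum_update_of_mem hj]
      rw [Finset.sum_eq_add_sum_sdiff_singleton_of_mem hj] at ih
      by_cases ha : Accepts (overflowProb μ) r (s.loads (overflowProb μ) r j)
      · simp only [refill, openCost, ha, if_true, add_zero]
        have := overflowProb_nonneg μ (s.usage j)
        linarith
      -- The relaxed usage is at most the actual one, which is at most 1 by feasibility, so only the
      -- budget can cause the rejection. The increment of the left side is then below `p(load) +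
      -- p(0)`, hence below twice the actual risk of the item.
      · have hlt : r < (s.loads (overflowProb μ) r j).2 +
            overflowProb μ (s.loads (overflowProb μ) r j).1 := by
          by_contra hlt
          exact ha ⟨(hle j hj).trans hu, not_lt.1 hlt⟩
        simp only [refill, openCost, ha, if_false]
        push_cast
        linarith
    · rw [Finset.sum_insert hj, Finset.card_insert_of_notMem hj, Finset.sum_update_of_notMem hj,
        loads_of_notMem _ _ _ hj]
      simp only [Function.update_self, refill, openCost, not_accepts_unused, if_false]
      push_cast
      have := overflowProb_nonneg μ (s.usage j)
      linarith

lemma mul_refills_le (s : State i) (h : ∀ k, 0 ≤ (s k).1) (hf : s.Feasible) :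
    r * s.refills (overflowProb μ) r ≤ r * s.opened.card + 2 * s.totalRisk μ :=
  (le_add_of_nonneg_right (Finset.sum_nonneg fun j _ => risk_loads_nonneg s j)).trans
    (mul_refills_add_le s h hf)

end Nonneg

end State

/-! ### Runs of policies -/

namespace Policy

lemma run_snoc (P : Policy) {n : ℕ} (x : Fin n → ℝ) (y : ℝ) :
    P.run (Fin.snoc (α := fun _ => ℝ) x y) = (P.run x).push y (P.bin n (P.run x)) := by
  simp only [run, Fin.init_snoc, Fin.snoc_last]
  rfl

lemma size_run (P : Policy) {n : ℕ} (x : Fin n → ℝ) (k : Fin n) : (P.run x k).1 = x k := by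
  induction n with
  | zero => exact k.elim0
  | succ n ih =>
    rw [← Fin.snoc_init_self x, run_snoc]
    refine Fin.lastCases ?_ (fun k => ?_) k
    · simp
    · simpa using ih (Fin.init x) k

end Policy

/-! ### Invariants of Budgeted Greedy -/

namespace IsBudgetedGreedy

variable {μ : Measure ℝ} {r : ℝ} {A : Policy}

lemma canAdd_or_isLeast (hA : IsBudgetedGreedy (fun _ => μ) r A) {n : ℕ} {x : Fin n → ℝ}
    (hx : ∀ k, 0 ≤ x k) :
    (A.run x).CanAdd (fun _ => μ) r (A.bin n (A.run x)) ∨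
      (∀ j, ¬ (A.run x).CanAdd (fun _ => μ) r j) ∧ A.bin n (A.run x) ∉ (A.run x).opened := by
  by_cases h : ∃ j, (A.run x).CanAdd (fun _ => μ) r j
  · exact Or.inl ((hA n x hx).1 h)
  · exact Or.inr ⟨not_exists.1 h, ((hA n x hx).2 h).1⟩

/-- Induction along the states that Budgeted Greedy reaches. -/
lemma run_induction (hA : IsBudgetedGreedy (fun _ => μ) r A) {motive : ∀ {i : ℕ}, State i → Prop}
    (zero : ∀ s : State 0, motive s)
    (push : ∀ {i : ℕ} (s : State i) (x : ℝ) (j : ℕ), (∀ k, 0 ≤ (s k).1) → 0 ≤ x → motive s →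
      (s.CanAdd (fun _ => μ) r j ∨ (∀ j, ¬ s.CanAdd (fun _ => μ) r j) ∧ j ∉ s.opened) →
      motive (s.push x j)) {n : ℕ} (x : Fin n → ℝ) (hx : ∀ k, 0 ≤ x k) : motive (A.run x) := by
  induction n with
  | zero => exact zero _
  | succ n ih =>
    have hx' : ∀ k, 0 ≤ Fin.init x k := fun k => hx k.castSucc
    rw [← Fin.snoc_init_self x, Policy.run_snoc]
    refine push _ _ _ (fun k => ?_) (hx _) (ih (Fin.init x) hx') (hA.canAdd_or_isLeast hx')
    rw [Policy.size_run]
    exact hx' k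

lemma tracks (hA : IsBudgetedGreedy (fun _ => μ) r A) {n : ℕ} (x : Fin n → ℝ)
    (hx : ∀ k, 0 ≤ x k) : (A.run x).Tracks μ r :=
  hA.run_induction (motive := State.Tracks μ r) State.tracks_zero
    (fun _ x _ _ _ hs hj => hs.push x (hj.symm.imp_left And.right)) x hx

lemma feasible (hA : IsBudgetedGreedy (fun _ => μ) r A) {n : ℕ} (x : Fin n → ℝ)
    (hx : ∀ k, 0 ≤ x k) : (A.run x).Feasible := by
  refine hA.run_induction (motive := State.Feasible) (fun s k => k.elim0)
    (fun s x j _ _ hs hj => State.feasible_push.2 ⟨hs, ?_⟩) x hx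
  rcases hj with hj | hj
  · exact hj.2.1
  · rw [State.usage_of_notMem hj.2]
    exact zero_le_one

/-- Additions to open bins respect the budget by the rule of the algorithm; `h0` is what keeps a
newly opened bin within it. -/
lemma risk_le (hA : IsBudgetedGreedy (fun _ => μ) r A) (hr : 0 ≤ r) (h0 : overflowProb μ 0 ≤ r)
    {n : ℕ} (x : Fin n → ℝ) (hx : ∀ k, 0 ≤ x k) (j : ℕ) :
    (A.run x).risk (fun _ => μ) j ≤ r := by
  refine hA.run_induction (motive := fun s => ∀ j, s.risk (fun _ => μ) j ≤ r)
    (fun s j => by simpa [State.risk] using hr) (fun s x k _ _ hs hk j => ?_) x hx j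
  rw [State.risk_push]
  split_ifs with hkj
  · subst hkj
    rcases hk with hk | hk
    · exact hk.2.2
    · rwa [State.usage_of_notMem hk.2, State.risk_of_notMem hk.2, zero_add]
  · simpa using hs j

lemma totalRisk_le_of_le (hA : IsBudgetedGreedy (fun _ => μ) r A) (hr : 0 ≤ r)
    (h0 : overflowProb μ 0 ≤ r) {n : ℕ} (x : Fin n → ℝ) (hx : ∀ k, 0 ≤ x k) :
    (A.run x).totalRisk μ ≤ r * (A.run x).opened.card := by
  rw [State.totalRisk_eq_sum_risk, mul_comm, ← nsmul_eq_mul]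
  exact Finset.sum_le_card_nsmul _ _ _ fun j _ => hA.risk_le hr h0 x hx j

variable [IsProbabilityMeasure μ]

/-- An item already exceeds the budget in an empty bin, and a fuller bin is no safer, so no open bin
ever qualifies and each item opens its own. -/
lemma totalRisk_le_of_lt (hA : IsBudgetedGreedy (fun _ => μ) r A)
    (h0 : r < overflowProb μ 0) {n : ℕ} (x : Fin n → ℝ) (hx : ∀ k, 0 ≤ x k) :
    (A.run x).totalRisk μ ≤ n * overflowProb μ 0 := by
  refine hA.run_induction (motive := fun {i} s => s.totalRisk μ ≤ i * overflowProb μ 0)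
    (fun s => by simp [State.totalRisk]) (fun {i} s x j hn _ hs hj => ?_) x hx
  rw [State.totalRisk_push]
  have hu : s.usage j = 0 := by
    rcases hj with hj | hj
    · have h1 := monotone_overflowProb μ (s.usage_nonneg hn j)
      have h2 : 0 ≤ s.risk (fun _ => μ) j :=
        Finset.sum_nonneg fun _ _ => overflowProb_nonneg μ _
      have := hj.2.2
      linarith
    · exact State.usage_of_notMem hj.2
  rw [hu]
  push_cast
  linarith

end IsBudgetedGreedy

/-! ### Measurability -/

namespace State

variable {i : ℕ}

lemma measurableSet_label (k : Fin i) (j : ℕ) : MeasurableSet {s : State i | (s k).2 = j} :=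
  (measurable_snd.comp (measurable_pi_apply k)) (measurableSet_singleton j)

lemma measurable_usage (j : ℕ) : Measurable fun s : State i => s.usage j := by
  simp only [usage, Finset.sum_filter]
  exact Finset.measurable_fun_sum _ fun k _ => Measurable.ite (measurableSet_label k j)
    (measurable_fst.comp (measurable_pi_apply k)) measurable_const

lemma measurable_usage_prod : Measurable fun q : State i × ℕ => q.1.usage q.2 :=
  measurable_from_prod_countable_left measurable_usage

lemma measurable_before (k : Fin i) : Measurable fun s : State i => s.before k :=
  measurable_pi_iff.2 fun _ => measurable_pi_apply _

lemma measurable_card_opened : Measurable fun s : State i => s.opened.card := by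
  have h : Measurable fun s : State i => fun k => (s k).2 :=
    measurable_pi_iff.2 fun k => measurable_snd.comp (measurable_pi_apply k)
  exact (Measurable.of_discrete (f := fun l : Fin i → ℕ => (Finset.univ.image l).card)).comp h

lemma measurable_card_broken : Measurable fun s : State i => s.broken.card := by
  have h : Measurable fun s : State i => fun k => (s k).2 :=
    measurable_pi_iff.2 fun k => measurable_snd.comp (measurable_pi_apply k)
  -- The index set of the sum depends on the state only through the labels, which form a countable
  -- space; fixing them leaves a finite sum over a constant set.
  have hg : Measurable fun q : State i × (Fin i → ℕ) =>
      ∑ j ∈ Finset.univ.image q.2, if 1 < q.1.usage j then 1 else 0 :=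
    measurable_from_prod_countable_left fun l =>
      Finset.measurable_fun_sum (Finset.univ.image l) fun j _ =>
        Measurable.ite (measurableSet_lt measurable_const (measurable_usage j))
          measurable_const measurable_const
  convert hg.comp (measurable_id.prodMk h) using 1
  ext1 s
  exact Finset.card_filter _ _

variable {μ : Measure ℝ}

lemma measurable_totalRisk [IsFiniteMeasure μ] : Measurable fun s : State i => s.totalRisk μ :=
  Finset.measurable_fun_sum _ fun k _ => (measurable_overflowProb μ).comp
    (measurable_usage_prod.comp
      ((measurable_before k).prodMk (measurable_snd.comp (measurable_pi_apply k))))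

lemma measurable_risk [IsFiniteMeasure μ] (j : ℕ) :
    Measurable fun s : State i => s.risk (fun _ => μ) j := by
  simp only [risk, Finset.sum_filter]
  exact Finset.measurable_fun_sum _ fun k _ => Measurable.ite (measurableSet_label k j)
    ((measurable_overflowProb μ).comp ((measurable_usage j).comp (measurable_before k)))
    measurable_const

lemma measurableSet_opened (j : ℕ) : MeasurableSet {s : State i | j ∈ s.opened} := by
  simp only [mem_opened, Set.ofPred_exists]
  exact MeasurableSet.iUnion fun k => measurableSet_label k j

lemma measurableSet_canAdd [IsFiniteMeasure μ] (r : ℝ) (j : ℕ) :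
    MeasurableSet {s : State i | s.CanAdd (fun _ => μ) r j} :=
  (measurableSet_opened j).inter ((measurableSet_le (measurable_usage j) measurable_const).inter
    (measurableSet_le ((measurable_risk j).add
      ((measurable_overflowProb μ).comp (measurable_usage j))) measurable_const))

lemma measurable_init :
    Measurable fun s : State (i + 1) => (Fin.init (α := fun _ => ℝ × ℕ) s : State i) :=
  measurable_pi_iff.2 fun _ => measurable_pi_apply _

lemma measurable_loads {p : ℝ → ℝ} (hp : Measurable p) (r : ℝ) :
    ∀ {i : ℕ}, Measurable fun s : State i => s.loads p r
  | 0 => measurable_const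
  | i + 1 => by
    have hφ : Measurable fun s : State (i + 1) =>
        loads p r (Fin.init (α := fun _ => ℝ × ℕ) s) := (measurable_loads hp r).comp measurable_init
    refine measurable_pi_iff.2 fun j => ?_
    have : (fun s : State (i + 1) => loads p r s j) = fun s => if (s (Fin.last i)).2 = j then
        refill p r (loads p r (Fin.init (α := fun _ => ℝ × ℕ) s) j) (s (Fin.last i)).1
        else loads p r (Fin.init (α := fun _ => ℝ × ℕ) s) j := by
      ext1 s
      split_ifs with h
      · simp only [loads, h, Function.update_self]
      · simp only [loads, Function.update_of_ne (Ne.symm h)]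
    rw [this]
    have hj := (measurable_pi_apply j).comp hφ
    exact Measurable.ite (measurableSet_label _ _) ((measurable_refill hp).comp
      (hj.prodMk (measurable_fst.comp (measurable_pi_apply _)))) hj

lemma measurable_openCost_loads {p : ℝ → ℝ} (hp : Measurable p) (r : ℝ) :
    Measurable fun q : State i × ℕ => openCost p r (q.1.loads p r q.2) :=
  measurable_from_prod_countable_left fun j =>
    (measurable_openCost hp).comp ((measurable_pi_apply j).comp (measurable_loads hp r))

lemma measurable_refills {p : ℝ → ℝ} (hp : Measurable p) (r : ℝ) :
    ∀ {i : ℕ}, Measurable fun s : State i => s.refills p r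
  | 0 => measurable_const
  | _ + 1 => ((measurable_refills hp r).comp measurable_init).add
      ((measurable_openCost_loads hp r).comp
        (measurable_init.prodMk (measurable_snd.comp (measurable_pi_apply _))))

end State

lemma Policy.measurable_run (P : Policy) :
    ∀ {n : ℕ}, Measurable fun x : Fin n → ℝ => P.run x
  | 0 => measurable_const
  | n + 1 => by
    have hrun : Measurable fun x : Fin (n + 1) → ℝ => P.run (Fin.init (α := fun _ => ℝ) x) :=
      P.measurable_run.comp (measurable_pi_iff.2 fun _ => measurable_pi_apply _)
    refine measurable_pi_iff.2 fun k => ?_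
    refine Fin.lastCases ?_ (fun k => ?_) k
    · simpa [run] using (measurable_pi_apply (Fin.last n)).prodMk ((P.measurable_bin n).comp hrun)
    · simpa [run, Function.comp_def] using (measurable_pi_apply k).comp hrun

/-- Budgeted Greedy exists. -/
lemma exists_isBudgetedGreedy (μ : Measure ℝ) [IsFiniteMeasure μ] (r : ℝ) :
    ∃ A : Policy, IsBudgetedGreedy (fun _ => μ) r A := by
  classical
  have hex (i : ℕ) (s : State i) : ∃ j, s.CanAdd (fun _ => μ) r j ∨
      (∀ l, ¬ s.CanAdd (fun _ => μ) r l) ∧ j ∉ s.opened := by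
    by_cases h : ∃ j, s.CanAdd (fun _ => μ) r j
    · exact h.imp fun j => Or.inl
    · obtain ⟨j, hj⟩ := Infinite.exists_notMem_finset s.opened
      exact ⟨j, Or.inr ⟨not_exists.1 h, hj⟩⟩
  -- Ties are broken by the smallest label, which also gives the smallest unused label when no bin
  -- qualifies.
  refine ⟨⟨fun i s => Nat.find (hex i s), fun i => measurable_find (hex i) fun j => ?_⟩,
    fun i x _ => ⟨fun h => ?_, fun h => ⟨?_, fun j hj => ?_⟩⟩⟩
  · have hall : MeasurableSet {s : State i | ∀ l, ¬ s.CanAdd (fun _ => μ) r l} := by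
      rw [Set.ofPred_forall]
      exact MeasurableSet.iInter fun l => (State.measurableSet_canAdd r l).compl
    exact (State.measurableSet_canAdd r j).union
      (hall.inter (State.measurableSet_opened j).compl)
  · exact (Nat.find_spec (hex i _)).resolve_right fun h' => absurd h (not_exists.2 h'.1)
  · exact ((Nat.find_spec (hex i _)).resolve_left fun h' => h ⟨_, h'⟩).2
  · exact Nat.find_min' _ (Or.inr ⟨not_exists.1 h, hj⟩)

/-! ### Expectations along the run of a policy -/

section Expectation

variable {μ : Measure ℝ} [IsProbabilityMeasure μ]

lemma measurePreserving_snoc (μ : Measure ℝ) [IsProbabilityMeasure μ] (n : ℕ) :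
    MeasurePreserving
      (fun q : (Fin n → ℝ) × ℝ => (Fin.snoc (α := fun _ => ℝ) q.1 q.2 : Fin (n + 1) → ℝ))
      ((Measure.pi fun _ : Fin n => μ).prod μ) (Measure.pi fun _ : Fin (n + 1) => μ) := by
  have h := (measurePreserving_piFinSuccAbove (fun _ : Fin (n + 1) => μ) (Fin.last n)).symm.comp
    (Measure.measurePreserving_swap (μ := Measure.pi fun _ : Fin n => μ) (ν := μ))
  convert h using 1
  ext q : 1
  exact (Fin.insertNth_last' _ _).symm

/-- Conditioning on the past: the bin is chosen before the last size is revealed, and that size is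
independent of the earlier ones. -/
lemma lintegral_run_succ (P : Policy) (n : ℕ) {f : State (n + 1) → ℝ≥0∞} (hf : Measurable f) :
    ∫⁻ z, f (P.run z) ∂(Measure.pi fun _ : Fin (n + 1) => μ) =
      ∫⁻ x, ∫⁻ y, f ((P.run x).push y (P.bin n (P.run x))) ∂μ ∂(Measure.pi fun _ : Fin n => μ) := by
  have hfP := hf.comp P.measurable_run
  have h := measurePreserving_snoc μ n
  refine (h.lintegral_comp hfP).symm.trans ?_
  refine (lintegral_prod _ (hfP.comp h.measurable).aemeasurable).trans ?_
  simp only [Function.comp, P.run_snoc]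

lemma ae_run_succ (P : Policy) (n : ℕ) {q : State (n + 1) → Prop}
    (hq : ∀ᵐ z ∂(Measure.pi fun _ : Fin (n + 1) => μ), q (P.run z)) :
    ∀ᵐ x ∂(Measure.pi fun _ : Fin n => μ), ∀ᵐ y ∂μ,
      q ((P.run x).push y (P.bin n (P.run x))) := by
  have h := Measure.ae_ae_of_ae_prod ((measurePreserving_snoc μ n).quasiMeasurePreserving.ae hq)
  simpa only [P.run_snoc] using h

lemma ae_pi_nonneg (hμ : ∀ᵐ x ∂μ, 0 ≤ x) (n : ℕ) :
    ∀ᵐ x ∂(Measure.pi fun _ : Fin n => μ), ∀ k, 0 ≤ x k :=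
  ae_all_iff.2 fun k =>
    (measurePreserving_eval (fun _ : Fin n => μ) k).quasiMeasurePreserving.ae hμ

/-- The expected number of overflows is the expected total risk. -/
lemma lintegral_card_broken (P : Policy) (n : ℕ)
    (hP : ∀ᵐ x ∂(Measure.pi fun _ : Fin n => μ), (P.run x).Feasible) :
    ∫⁻ x, ((P.run x).broken.card : ℝ≥0∞) ∂(Measure.pi fun _ : Fin n => μ) =
      ∫⁻ x, ENNReal.ofReal ((P.run x).totalRisk μ) ∂(Measure.pi fun _ : Fin n => μ) := by
  induction n with
  | zero => simp [State.broken, State.opened, State.totalRisk]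
  | succ n ih =>
    have hstep : ∀ᵐ x ∂(Measure.pi fun _ : Fin n => μ),
        (P.run x).Feasible ∧ (P.run x).usage (P.bin n (P.run x)) ≤ 1 := by
      filter_upwards [ae_run_succ P n hP] with x hx
      -- Feasibility does not involve the size of the last item, so a single value of it suffices.
      obtain ⟨y, hy⟩ := hx.exists
      exact State.feasible_push.1 hy
    have hR : Measurable fun x : Fin n → ℝ => (P.run x).totalRisk μ :=
      State.measurable_totalRisk.comp P.measurable_run
    rw [lintegral_run_succ P n (f := fun s => (s.broken.card : ℝ≥0∞))
      (measurable_from_top.comp State.measurable_card_broken),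
      lintegral_run_succ P n (f := fun s => ENNReal.ofReal (s.totalRisk μ))
      State.measurable_totalRisk.ennreal_ofReal]
    have hleft : ∀ᵐ x ∂(Measure.pi fun _ : Fin n => μ),
        ∫⁻ y, (((P.run x).push y (P.bin n (P.run x))).broken.card : ℝ≥0∞) ∂μ =
          ((P.run x).broken.card : ℝ≥0∞) +
            ENNReal.ofReal (overflowProb μ ((P.run x).usage (P.bin n (P.run x)))) := by
      filter_upwards [hstep] with x hx
      -- The chosen bin is intact, so the new item adds one overflow exactly on this event, whose
      -- probability is the risk it adds.
      have hset : MeasurableSet {y : ℝ | 1 < y + (P.run x).usage (P.bin n (P.run x))} :=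
        measurableSet_lt measurable_const (measurable_id.add_const _)
      have hind (y : ℝ) : (((P.run x).push y (P.bin n (P.run x))).broken.card : ℝ≥0∞) =
          ((P.run x).broken.card : ℝ≥0∞) +
          {y : ℝ | 1 < y + (P.run x).usage (P.bin n (P.run x))}.indicator 1 y := by
        rw [State.card_broken_push hx.2]
        simp [Set.indicator_apply]
      simp only [hind]
      rw [lintegral_add_left measurable_const, lintegral_indicator_one hset, overflowProb,
        ofReal_measureReal]
      simp
    have hB : Measurable fun x : Fin n → ℝ => ((P.run x).broken.card : ℝ≥0∞) :=
      measurable_from_top.comp (State.measurable_card_broken.comp P.measurable_run)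
    rw [lintegral_congr_ae hleft, lintegral_add_left hB,
      ih (hstep.mono fun _ h => h.1), ← lintegral_add_left hR.ennreal_ofReal]
    refine lintegral_congr fun x => ?_
    simp only [State.totalRisk_push, lintegral_const, measure_univ, mul_one]
    exact (ENNReal.ofReal_add (State.totalRisk_nonneg _) (overflowProb_nonneg _ _)).symm

lemma lintegral_refills_succ (P : Policy) {p : ℝ → ℝ} (hp : Measurable p) (r : ℝ) (n m : ℕ) :
    ∫⁻ x, (((P.run x).refills p r : ℝ≥0∞) + minOpen p r μ m ((P.run x).loads p r))
        ∂(Measure.pi fun _ : Fin (n + 1) => μ) =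
      ∫⁻ x, (((P.run x).refills p r : ℝ≥0∞) +
        ((openCost p r ((P.run x).loads p r (P.bin n (P.run x))) : ℝ≥0∞) +
          ∫⁻ y, minOpen p r μ m (Function.update ((P.run x).loads p r) (P.bin n (P.run x))
            (refill p r ((P.run x).loads p r (P.bin n (P.run x))) y)) ∂μ))
        ∂(Measure.pi fun _ : Fin n => μ) := by
  rw [lintegral_run_succ P n
    (f := fun s => (s.refills p r : ℝ≥0∞) + minOpen p r μ m (s.loads p r))
    ((measurable_from_top.comp (State.measurable_refills hp r)).add
      ((measurable_minOpen hp m).comp (State.measurable_loads hp r)))]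
  refine lintegral_congr fun x => ?_
  simp only [State.refills_push, State.loads_push]
  rw [lintegral_add_left measurable_const]
  simp [add_assoc]

/-- Every policy uses at least `minOpen` bins if bins with an exhausted budget are replaced. -/
lemma minOpen_le_lintegral_refills (P : Policy) {p : ℝ → ℝ} (hp : Measurable p) (r : ℝ)
    (n m : ℕ) :
    minOpen p r μ (n + m) (fun _ => (2, 0)) ≤
      ∫⁻ x, (((P.run x).refills p r : ℝ≥0∞) + minOpen p r μ m ((P.run x).loads p r))
        ∂(Measure.pi fun _ : Fin n => μ) := by
  induction n generalizing m with
  | zero => simp [State.refills, State.loads]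
  | succ n ih =>
    rw [lintegral_refills_succ P hp, add_assoc, add_comm 1 m]
    exact (ih (m + 1)).trans (lintegral_mono fun x => by gcongr; exact minOpen_succ_le _ _ _)

/-- Each greedy choice attains the infimum in the Bellman recursion, so count so far plus optimal
remaining cost has constant expectation; for a general policy it can only grow. -/
lemma lintegral_refills_greedy {r : ℝ} {A : Policy} (hA : IsBudgetedGreedy (fun _ => μ) r A)
    (hμ : ∀ᵐ x ∂μ, 0 ≤ x) (n m : ℕ) :
    ∫⁻ x, (((A.run x).refills (overflowProb μ) r : ℝ≥0∞) +
        minOpen (overflowProb μ) r μ m ((A.run x).loads (overflowProb μ) r))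
        ∂(Measure.pi fun _ : Fin n => μ) =
      minOpen (overflowProb μ) r μ (n + m) (fun _ => (2, 0)) := by
  have hp := measurable_overflowProb μ
  induction n generalizing m with
  | zero => simp [State.refills, State.loads]
  | succ n ih =>
    rw [lintegral_refills_succ A hp, add_assoc, add_comm 1 m, ← ih (m + 1)]
    refine lintegral_congr_ae ?_
    filter_upwards [ae_pi_nonneg hμ n] with x hx
    have ht := hA.tracks x hx
    congr 1
    rcases hA.canAdd_or_isLeast hx with h | h
    · have ha := (ht.accepts_iff _).2 h
      rw [minOpen_succ_of_accepts hp m _ _ ha]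
      simp [openCost, ha]
    · exact (minOpen_succ_of_not_accepts hp m _
        (fun j hj => h.1 j ((ht.accepts_iff j).1 hj)) _).symm

/-- Budgeted Greedy opens the fewest bins, even against policies whose bins are replaced when
their budget is exhausted. -/
lemma lintegral_card_opened_greedy_le {r : ℝ} {A : Policy}
    (hA : IsBudgetedGreedy (fun _ => μ) r A) (hμ : ∀ᵐ x ∂μ, 0 ≤ x) (P : Policy) (n : ℕ) :
    ∫⁻ x, ((A.run x).opened.card : ℝ≥0∞) ∂(Measure.pi fun _ : Fin n => μ) ≤
      ∫⁻ x, ((P.run x).refills (overflowProb μ) r : ℝ≥0∞) ∂(Measure.pi fun _ : Fin n => μ) := by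
  have h1 := lintegral_refills_greedy hA hμ n 0
  have h2 := minOpen_le_lintegral_refills (μ := μ) P (measurable_overflowProb μ) r n 0
  simp only [minOpen, add_zero] at h1 h2
  calc ∫⁻ x, ((A.run x).opened.card : ℝ≥0∞) ∂(Measure.pi fun _ : Fin n => μ)
      = ∫⁻ x, ((A.run x).refills (overflowProb μ) r : ℝ≥0∞) ∂(Measure.pi fun _ : Fin n => μ) := by
        refine lintegral_congr_ae ?_
        filter_upwards [ae_pi_nonneg hμ n] with x hx
        rw [(hA.tracks x hx).2]
    _ ≤ _ := h1.trans_le h2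

end Expectation

/-! ### Bounds ensuring integrability, and measurability of the constraints -/

namespace State

variable {i : ℕ}

lemma card_opened_le (s : State i) : s.opened.card ≤ i :=
  Finset.card_image_le.trans (by simp)

lemma refills_le (p : ℝ → ℝ) (r : ℝ) (s : State i) : s.refills p r ≤ i := by
  induction s using pushInduction with
  | zero s => exact le_rfl
  | push s x j ih =>
    rw [refills_push]
    refine add_le_add ih ?_
    rw [openCost]
    split_ifs <;> simp

lemma measurableSet_feasible : MeasurableSet {s : State i | s.Feasible} := by
  simp only [Feasible, Set.ofPred_forall]
  exact MeasurableSet.iInter fun k => measurableSet_le (measurable_usage_prod.comp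
    ((measurable_before k).prodMk (measurable_snd.comp (measurable_pi_apply k)))) measurable_const

lemma measurableSet_budgeted (μ : Measure ℝ) [IsFiniteMeasure μ] (r : ℝ) :
    MeasurableSet {s : State i | ∀ j, s.risk (fun _ => μ) j ≤ r} := by
  simp only [Set.ofPred_forall]
  exact MeasurableSet.iInter fun j => measurableSet_le (measurable_risk j) measurable_const

end State

section Moments

variable {α : Type*} [MeasurableSpace α] {ν : Measure α} {f : α → ℕ}

lemma integrable_natCast_of_le [IsFiniteMeasure ν] (hf : Measurable f) {b : ℕ}
    (hb : ∀ x, f x ≤ b) : Integrable (fun x => (f x : ℝ)) ν := by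
  refine Integrable.of_bound (C := b) (measurable_from_top.comp hf).aestronglyMeasurable
    (ae_of_all _ fun x => ?_)
  simpa using hb x

lemma integral_natCast_eq_toReal (hf : Measurable f) :
    ∫ x, (f x : ℝ) ∂ν = (∫⁻ x, (f x : ℝ≥0∞) ∂ν).toReal := by
  rw [integral_eq_lintegral_of_nonneg_ae (ae_of_all _ fun x => Nat.cast_nonneg _)
    (measurable_from_top.comp hf).aestronglyMeasurable]
  simp

lemma lintegral_natCast_ne_top [IsFiniteMeasure ν] {b : ℕ} (hb : ∀ x, f x ≤ b) :
    ∫⁻ x, (f x : ℝ≥0∞) ∂ν ≠ ∞ := by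
  refine ((lintegral_mono fun x => Nat.cast_le.2 (hb x)).trans_lt ?_).ne
  rw [lintegral_const]
  exact ENNReal.mul_lt_top (ENNReal.natCast_lt_top b) (measure_lt_top ν _)

end Moments

/-! ### Comparison of expectations under the product law -/

section Bounds

variable {μ : Measure ℝ} [IsProbabilityMeasure μ] {n : ℕ}

lemma integral_card_broken (P : Policy)
    (hP : ∀ᵐ x ∂(Measure.pi fun _ : Fin n => μ), (P.run x).Feasible) :
    ∫ x, ((P.run x).broken.card : ℝ) ∂(Measure.pi fun _ : Fin n => μ) =
      ∫ x, (P.run x).totalRisk μ ∂(Measure.pi fun _ : Fin n => μ) := by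
  rw [integral_natCast_eq_toReal (f := fun x => (P.run x).broken.card)
      (State.measurable_card_broken.comp P.measurable_run),
    lintegral_card_broken P n hP,
    integral_eq_lintegral_of_nonneg_ae (ae_of_all _ fun x => State.totalRisk_nonneg _)
    (State.measurable_totalRisk.comp P.measurable_run).aestronglyMeasurable]

lemma integrable_totalRisk (P : Policy) :
    Integrable (fun x => (P.run x).totalRisk μ) (Measure.pi fun _ : Fin n => μ) := by
  refine Integrable.of_bound (C := n)
    (State.measurable_totalRisk.comp P.measurable_run).aestronglyMeasurable
    (ae_of_all _ fun x => ?_)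
  rw [Real.norm_of_nonneg (State.totalRisk_nonneg _)]
  exact State.totalRisk_le _

lemma integrable_card_opened (P : Policy) :
    Integrable (fun x => ((P.run x).opened.card : ℝ)) (Measure.pi fun _ : Fin n => μ) :=
  integrable_natCast_of_le (State.measurable_card_opened.comp P.measurable_run) fun x =>
    (P.run x).card_opened_le

lemma integrable_refills (P : Policy) (r : ℝ) :
    Integrable (fun x => ((P.run x).refills (overflowProb μ) r : ℝ))
      (Measure.pi fun _ : Fin n => μ) :=
  integrable_natCast_of_le ((State.measurable_refills (measurable_overflowProb μ) r).comp
    P.measurable_run) fun x => (P.run x).refills_le _ _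

variable {r : ℝ} {A : Policy}

lemma integral_card_opened_greedy_le (hA : IsBudgetedGreedy (fun _ => μ) r A)
    (hμ : ∀ᵐ x ∂μ, 0 ≤ x) (P : Policy) :
    ∫ x, ((A.run x).opened.card : ℝ) ∂(Measure.pi fun _ : Fin n => μ) ≤
      ∫ x, ((P.run x).refills (overflowProb μ) r : ℝ) ∂(Measure.pi fun _ : Fin n => μ) := by
  rw [integral_natCast_eq_toReal (f := fun x => (A.run x).opened.card)
      (State.measurable_card_opened.comp A.measurable_run),
    integral_natCast_eq_toReal (f := fun x => (P.run x).refills (overflowProb μ) r)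
      ((State.measurable_refills (measurable_overflowProb μ) r).comp P.measurable_run)]
  exact ENNReal.toReal_mono (lintegral_natCast_ne_top fun x => (P.run x).refills_le _ _)
    (lintegral_card_opened_greedy_le hA hμ P n)

lemma integral_card_opened_greedy_le_of_budgeted (hA : IsBudgetedGreedy (fun _ => μ) r A)
    (hμ : ∀ᵐ x ∂μ, 0 ≤ x) (P : Policy)
    (hP : ∀ᵐ x ∂(Measure.pi fun _ : Fin n => μ), (P.run x).Feasible)
    (hPr : ∀ᵐ x ∂(Measure.pi fun _ : Fin n => μ), ∀ j, (P.run x).risk (fun _ => μ) j ≤ r) :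
    ∫ x, ((A.run x).opened.card : ℝ) ∂(Measure.pi fun _ : Fin n => μ) ≤
      ∫ x, ((P.run x).opened.card : ℝ) ∂(Measure.pi fun _ : Fin n => μ) := by
  refine (integral_card_opened_greedy_le hA hμ P).trans_eq (integral_congr_ae ?_)
  filter_upwards [hP, hPr] with x hf hr
  rw [(State.tracks_of_budgeted _ hf hr).2]

lemma mul_integral_card_opened_greedy_le (hA : IsBudgetedGreedy (fun _ => μ) r A) (hr : 0 ≤ r)
    (hμ : ∀ᵐ x ∂μ, 0 ≤ x) (P : Policy)
    (hP : ∀ᵐ x ∂(Measure.pi fun _ : Fin n => μ), (P.run x).Feasible) :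
    r * ∫ x, ((A.run x).opened.card : ℝ) ∂(Measure.pi fun _ : Fin n => μ) ≤
      r * ∫ x, ((P.run x).opened.card : ℝ) ∂(Measure.pi fun _ : Fin n => μ) +
        2 * ∫ x, ((P.run x).broken.card : ℝ) ∂(Measure.pi fun _ : Fin n => μ) := by
  refine (mul_le_mul_of_nonneg_left (integral_card_opened_greedy_le hA hμ P) hr).trans ?_
  rw [integral_card_broken P hP, ← integral_const_mul, ← integral_const_mul,
    ← integral_const_mul, ← integral_add ((integrable_card_opened P).const_mul r)
    ((integrable_totalRisk P).const_mul 2)]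
  refine integral_mono_ae ((integrable_refills P r).const_mul r)
    (((integrable_card_opened P).const_mul r).add ((integrable_totalRisk P).const_mul 2)) ?_
  filter_upwards [ae_pi_nonneg hμ n, hP] with x hx hf
  exact State.mul_refills_le _ (fun k => (P.size_run x k).symm ▸ hx k) hf

lemma integral_card_broken_greedy_le (hA : IsBudgetedGreedy (fun _ => μ) r A) (hr : 0 ≤ r)
    (hμ : ∀ᵐ x ∂μ, 0 ≤ x) (P : Policy)
    (hP : ∀ᵐ x ∂(Measure.pi fun _ : Fin n => μ), (P.run x).Feasible) :
    ∫ x, ((A.run x).broken.card : ℝ) ∂(Measure.pi fun _ : Fin n => μ) ≤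
        r * ∫ x, ((A.run x).opened.card : ℝ) ∂(Measure.pi fun _ : Fin n => μ) ∨
      ∫ x, ((A.run x).broken.card : ℝ) ∂(Measure.pi fun _ : Fin n => μ) ≤
        ∫ x, ((P.run x).broken.card : ℝ) ∂(Measure.pi fun _ : Fin n => μ) := by
  rw [integral_card_broken P hP,
    integral_card_broken A ((ae_pi_nonneg hμ n).mono fun x hx => hA.feasible x hx)]
  -- Either the budget controls every greedy bin, or every item sits alone and the greedy total risk
  -- is minimal among all policies.
  rcases le_or_gt (overflowProb μ 0) r with h0 | h0
  · left
    rw [← integral_const_mul]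
    refine integral_mono_ae (integrable_totalRisk A) ((integrable_card_opened A).const_mul r) ?_
    filter_upwards [ae_pi_nonneg hμ n] with x hx
    exact hA.totalRisk_le_of_le hr h0 x hx
  · right
    refine integral_mono_ae (integrable_totalRisk A) (integrable_totalRisk P) ?_
    filter_upwards [ae_pi_nonneg hμ n] with x hx
    exact (hA.totalRisk_le_of_lt h0 x hx).trans
      (State.mul_overflowProb_zero_le_totalRisk _ fun k => (P.size_run x k).symm ▸ hx k)

end Bounds

/-! ### Random items -/

section Items

variable {μ : Measure ℝ} {n : ℕ} {Ω : Type*} [MeasurableSpace Ω] {Pr : Measure Ω}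
  {X : Fin n → Ω → ℝ}

lemma hasLaw_items [IsProbabilityMeasure Pr] (hindep : iIndepFun X Pr)
    (hlaw : ∀ i, HasLaw (X i) μ Pr) :
    HasLaw (fun ω i => X i ω) (Measure.pi fun _ : Fin n => μ) Pr where
  aemeasurable := aemeasurable_pi_lambda _ fun i => (hlaw i).aemeasurable
  map_eq := by
    rw [(iIndepFun_iff_map_fun_eq_pi_map fun i => (hlaw i).aemeasurable).1 hindep]
    simp only [(hlaw _).map_eq]

lemma ae_items_iff (hX : HasLaw (fun ω i => X i ω) (Measure.pi fun _ : Fin n => μ) Pr)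
    (P : Policy) {q : State n → Prop} (hq : MeasurableSet {s | q s}) :
    (∀ᵐ ω ∂Pr, q (P.run fun i => X i ω)) ↔
      ∀ᵐ x ∂(Measure.pi fun _ : Fin n => μ), q (P.run x) := by
  rw [← hX.map_eq]
  exact (ae_map_iff hX.aemeasurable (P.measurable_run hq)).symm

lemma expectedOpened_eq (hX : HasLaw (fun ω i => X i ω) (Measure.pi fun _ : Fin n => μ) Pr)
    (P : Policy) : P.expectedOpened X Pr =
    ∫ x, ((P.run x).opened.card : ℝ) ∂(Measure.pi fun _ : Fin n => μ) := by
  have h : Measurable fun x : Fin n → ℝ => ((P.run x).opened.card : ℝ) :=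
    measurable_from_top.comp (State.measurable_card_opened.comp P.measurable_run)
  rw [← hX.map_eq, integral_map hX.aemeasurable h.aestronglyMeasurable]
  rfl

lemma expectedBroken_eq (hX : HasLaw (fun ω i => X i ω) (Measure.pi fun _ : Fin n => μ) Pr)
    (P : Policy) : P.expectedBroken X Pr =
    ∫ x, ((P.run x).broken.card : ℝ) ∂(Measure.pi fun _ : Fin n => μ) := by
  have h : Measurable fun x : Fin n → ℝ => ((P.run x).broken.card : ℝ) :=
    measurable_from_top.comp (State.measurable_card_broken.comp P.measurable_run)
  rw [← hX.map_eq, integral_map hX.aemeasurable h.aestronglyMeasurable]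
  rfl

end Items

end BinPacking

end

theorem theorem2 (μ : MeasureTheory.Measure ℝ) [MeasureTheory.IsProbabilityMeasure μ]
    (hμ : ∀ᵐ x ∂μ, 0 ≤ x) (C : ℝ) (hC : 1 ≤ C)
    (n : ℕ) {Ω : Type*} [MeasurableSpace Ω] (Pr : MeasureTheory.Measure Ω)
    [MeasureTheory.IsProbabilityMeasure Pr] (X : Fin n → Ω → ℝ)
    (hindep : ProbabilityTheory.iIndepFun X Pr)
    (hlaw : ∀ i, ProbabilityTheory.HasLaw (X i) μ Pr) :
    (∀ γ : ℝ, 0 < γ →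
      (∃ A : BinPacking.Policy, BinPacking.IsBudgetedGreedy (fun _ => μ) (γ / C) A) ∧
      ∀ A : BinPacking.Policy, BinPacking.IsBudgetedGreedy (fun _ => μ) (γ / C) A →
        A.IsFeasible X Pr ∧
        (μ.real (Set.Ioi 1) ≤ γ / C → A.IsBudgeted (fun _ => μ) (γ / C) X Pr) ∧
        ∀ P : BinPacking.Policy, P.IsFeasible X Pr → P.IsBudgeted (fun _ => μ) (γ / C) X Pr →
          A.expectedOpened X Pr ≤ P.expectedOpened X Pr) ∧
    (∀ A : BinPacking.Policy, BinPacking.IsBudgetedGreedy (fun _ => μ) (√2 / C) A →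
      ∀ P : BinPacking.Policy, P.IsFeasible X Pr →
        A.cost C X Pr ≤ (3 + 2 * √2) * P.cost C X Pr) := by
  have hC0 : 0 < C := one_pos.trans_le hC
  have hX := BinPacking.hasLaw_items hindep hlaw
  have hfeas (P : BinPacking.Policy) := BinPacking.ae_items_iff hX P
    BinPacking.State.measurableSet_feasible
  refine ⟨fun γ hγ => ⟨BinPacking.exists_isBudgetedGreedy μ _, fun A hA => ⟨?_, fun h0 => ?_,
    fun P hP hPr => ?_⟩⟩, fun A hA P hP => ?_⟩
  · exact (hfeas A).2 ((BinPacking.ae_pi_nonneg hμ n).mono fun x hx => hA.feasible x hx)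
  · have h0' : BinPacking.overflowProb μ 0 ≤ γ / C := by
      simpa [BinPacking.overflowProb, Set.Ioi] using h0
    exact (BinPacking.ae_items_iff hX A (BinPacking.State.measurableSet_budgeted μ _)).2
      ((BinPacking.ae_pi_nonneg hμ n).mono fun x hx => hA.risk_le (by positivity) h0' x hx)
  · rw [BinPacking.expectedOpened_eq hX, BinPacking.expectedOpened_eq hX]
    exact BinPacking.integral_card_opened_greedy_le_of_budgeted hA hμ P ((hfeas P).1 hP)
      ((BinPacking.ae_items_iff hX P (BinPacking.State.measurableSet_budgeted μ _)).1 hPr)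
  · have hr : 0 ≤ √2 / C := by positivity
    have h1 := BinPacking.mul_integral_card_opened_greedy_le hA hr hμ P ((hfeas P).1 hP)
    have h2 := BinPacking.integral_card_broken_greedy_le hA hr hμ P ((hfeas P).1 hP)
    simp only [BinPacking.Policy.cost]
    rw [← BinPacking.expectedOpened_eq hX, ← BinPacking.expectedOpened_eq hX,
      ← BinPacking.expectedBroken_eq hX] at h1
    rw [← BinPacking.expectedOpened_eq hX, ← BinPacking.expectedBroken_eq hX,
      ← BinPacking.expectedBroken_eq hX] at h2
    have hN : 0 ≤ P.expectedOpened X Pr := integral_nonneg fun _ => Nat.cast_nonneg _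
    have hO : 0 ≤ C * P.expectedBroken X Pr :=
      mul_nonneg hC0.le (integral_nonneg fun _ => Nat.cast_nonneg _)
    have hs : √2 * √2 = 2 := Real.mul_self_sqrt zero_le_two
    have hs0 : 0 < √2 := by positivity
    -- For budget `√2 / C` the charging factor 2/r equals √2·C.
    have hopen : A.expectedOpened X Pr ≤
        P.expectedOpened X Pr + √2 * (C * P.expectedBroken X Pr) := by
      refine le_of_mul_le_mul_left ?_ hs0
      calc √2 * A.expectedOpened X Pr = C * (√2 / C * A.expectedOpened X Pr) := by field_simp
        _ ≤ C * (√2 / C * P.expectedOpened X Pr + 2 * P.expectedBroken X Pr) := by gcongr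
        _ = √2 * P.expectedOpened X Pr + 2 * (C * P.expectedBroken X Pr) := by field_simp
        _ = _ := by rw [mul_add, ← mul_assoc √2 √2, hs]
    rcases h2 with h2 | h2
    · have hbroken : C * A.expectedBroken X Pr ≤ √2 * A.expectedOpened X Pr := by
        calc C * A.expectedBroken X Pr ≤ C * (√2 / C * A.expectedOpened X Pr) := by gcongr
          _ = √2 * A.expectedOpened X Pr := by field_simp
      -- The cost is at most (1 + √2) times the number of opened bins, giving coefficients 1 + √2
      -- for the bins of `P` and 2 + √2 for its penalty, both below 3 + 2√2.
      nlinarith [mul_le_mul_of_nonneg_left hopen hs0.le, mul_nonneg hs0.le hN,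
        mul_nonneg hs0.le hO]
    · have hbroken := mul_le_mul_of_nonneg_left h2 hC0.le
      nlinarith [mul_nonneg hs0.le hN, mul_nonneg hs0.le hO]
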